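/- **Setting.** Let $n,K\ge 0$ be integers. Robots $i\in\{1,\dots,n\}$ have given initial states $x_{i,0}$ and dynamics $x_{i,k+1}=f_i(x_{i,k},u_{i,k})$. Robot $i$ has a finite set $\mathcal M_i$ of available control trajectories $\sigma=(u_{i,0},\dots,u_{i,K-1})$. Trajectories are labelled by their robot, so the $\mathcal M_i$ are disjoint; $\mathcal M=\bigcup_i\mathcal M_i$, $N=|\mathcal M|$, and $\mathcal I=\{\mathcal S\subseteq\mathcal M : |\mathcal S\cap\mathcal M_i|\le 1\ \forall i\}$. The target state $y_k\in\mathbb R^{d_y}$ satisfies $y_{k+1}=A_ky_k+w_k$, $w_k\sim\mathcal N(0,W_k)$ with $W_k\succeq 0$ and Gaussian $y_0$ with covariance $\Sigma_0\succeq 0$. Robot $i$ in state $x$ at time $k$ measures $z_{i,k}=H_{i,k}(x)y_k+v_{i,k}$, $v_{i,k}\sim\mathcal N(0,V_{i,k}(x))$ with $V_{i,k}(x)\succ 0$; all noises and $y_0$ are independent. The covariance of $y_k$ is assumed to be positive definite for $1\le k\le K$. For $\mathcal S\subseteq\mathcal M$ let $\Sigma_{\mathcal S,0}=\Sigma_0$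 and, for $0\le k<K$, $$P_{\mathcal S,k+1}=A_k\Sigma_{\mathcal S,k}A_k^\top+W_k,\qquad \Sigma_{\mathcal S,k+1}=\Big(P_{\mathcal S,k+1}^{-1}+\sum_{\sigma\in\mathcal S}M_{\sigma,k+1}\Big)^{-1},\qquad M_{\sigma,k}=H^\top V^{-1}H,$$ where, for $\sigma\in\mathcal M_i$, $H=H_{i,k}$ and $V=V_{i,k}$ are evaluated at the state that robot $i$ reaches at time $k$ under $\sigma$. The mutual information between $y_{1:K}$ and the measurements $z_{\mathcal S,1:K}$ is $$\mathbb I(\mathcal S)=\tfrac12\sum_{k=1}^K\big[\log\det P_{\mathcal S,k}-\log\det\Sigma_{\mathcal S,k}\big].$$ With weights $m_i\ge 0$, a bound $c^{\max}\ge 0$ and energy costs $0\le C_i(\sigma)\le c^{\max}$ for $\sigma\in\mathcal M_i$, put $$J(\mathcal S)=\mathbb I(\mathcal S)-\sum_{i}\ \sum_{\sigma\in\mathcal S\cap\mathcal M_i}m_iC_i(\sigma),\qquad \lambda=\sum_{i=1}^n m_ic^{\max},\qquad g=J+\lambda .$$ **Centralized local search** with parameter $\alpha>0$ and oracle $g$.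 There are two rounds $\kappa=1,2$. Round 1 uses the ground set $\mathcal M$ and round 2 the ground set $\mathcal M\setminus\mathcal S_1$. A round starts with $\mathcal S_\kappa=\{a\}$ for some $a$ in its ground set that maximizes $g(\{a\})$ ($\mathcal S_\kappa=\emptyset$ if the ground set is empty). As long as deleting an element of $\mathcal S_\kappa$, adding an element of the ground set outside $\mathcal S_\kappa$, or swapping an element of $\mathcal S_\kappa$ for one outside can produce some $\mathcal S'\in\mathcal I$ with $g(\mathcal S')\ge(1+\alpha/N^4)\,g(\mathcal S_\kappa)$, such an $\mathcal S'$ replaces $\mathcal S_\kappa$; otherwise the round ends. Ties and the order of operations are arbitrary. The better of $\mathcal S_1,\mathcal S_2$ with respect to $g$ is returned as $\mathcal S^{\mathrm{ls}}$. **Proposition.** The offset objective satisfies $g(\mathcal S)\ge 0$ for all $\mathcal S\in\mathcal I$. For every maximizer $\mathcal S^*$ of $g$ over $\mathcal I$ and every set $\mathcal S^{\mathrm{ls}}$ that the centralized local search can return, $\mathcal S^{\mathrm{ls}}\in\mathcal I$ and $$0\le g(\mathcal S^*)\le 4(1+\alpha)\,g(\mathcal S^{\mathrm{ls}}).$$ Moreover,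 if $\lambda>0$, or if $g(\{a\})>0$ for all $a\in\mathcal M$, then some execution of the local search terminates, so that such a set $\mathcal S^{\mathrm{ls}}$ exists. -/

import Mathlib

open scoped Matrix

/-! ### Centralized local search for a set function -/

namespace LocalSearch

variable {E : Type*} [DecidableEq E]

/-- Initialization of a round on the ground set `M`: a singleton of largest value
(any maximizer may be picked). If `M` is empty, the candidate keeps its initial value `∅`. -/
def IsInit (g : Finset E → ℝ) (M S : Finset E) : Prop :=
  (M = ∅ ∧ S = ∅) ∨ ∃ a ∈ M, S = {a} ∧ ∀ b ∈ M, g {b} ≤ g {a}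

/-- `S'` results from `S` by one local operation (delete, add or swap) over the ground set `M`. -/
def LocalOp (M S S' : Finset E) : Prop :=
  (∃ d ∈ S, S' = S.erase d) ∨
  (∃ a ∈ M \ S, S' = insert a S) ∨
  (∃ d ∈ S, ∃ a ∈ M \ S, S' = insert a (S.erase d))

/-- One iteration of the while loop: a local operation that keeps the set admissible and reaches
at least the factor `1 + α / N ^ 4` of the current value. -/
def Step (adm : Finset E → Prop) (g : Finset E → ℝ) (α : ℝ) (N : ℕ) (M S S' : Finset E) : Prop :=
  LocalOp M S S' ∧ adm S' ∧ (1 + α / (N : ℝ) ^ 4) * g S ≤ g S'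

/-- `S` is a possible final candidate of a round on the ground set `M`: it is reached from an
initial candidate by finitely many iterations, and no further iteration is possible. -/
def IsRoundResult (adm : Finset E → Prop) (g : Finset E → ℝ) (α : ℝ) (N : ℕ)
    (M S : Finset E) : Prop :=
  ∃ S₀, IsInit g M S₀ ∧ Relation.ReflTransGen (Step adm g α N M) S₀ S ∧
    ∀ S', ¬ Step adm g α N M S S'

/-- `S` is a possible return value of the two-round local search on the ground set `M`.
The second round uses the ground set without the first candidate, but the same number
`N = |M|`; the better candidate is returned. All choices (ties, order of operations) are free. -/
def IsOutput (adm : Finset E → Prop) (g : Finset E → ℝ) (α : ℝ) (M S : Finset E) : Prop :=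
  ∃ S₁ S₂, IsRoundResult adm g α M.card M S₁ ∧ IsRoundResult adm g α M.card (M \ S₁) S₂ ∧
    ((S = S₁ ∧ g S₂ ≤ g S₁) ∨ (S = S₂ ∧ g S₁ ≤ g S₂))

end LocalSearch

/-! ### The energy-aware informative planning problem -/

/-- The data of the planning problem. -/
structure PlanningProblem where
  /-- number of robots -/
  n : ℕ
  /-- planning horizon -/
  K : ℕ
  /-- dimension of the target state -/
  dy : ℕ
  /-- dimensions of the measurements -/
  dz : Fin n → ℕ
  /-- state spaces of the robots -/
  X : Fin n → Type*
  /-- control sets of the robots -/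
  U : Fin n → Type*
  /-- dynamics of the robots -/
  f : ∀ i, X i → U i → X i
  /-- initial states of the robots -/
  x₀ : ∀ i, X i
  /-- target motion matrices -/
  A : ℕ → Matrix (Fin dy) (Fin dy) ℝ
  /-- covariances of the target motion noise -/
  W : ℕ → Matrix (Fin dy) (Fin dy) ℝ
  /-- prior covariance of the target state at time `0` -/
  Sigma₀ : Matrix (Fin dy) (Fin dy) ℝ
  /-- observation matrices -/
  H : ∀ i, ℕ → X i → Matrix (Fin (dz i)) (Fin dy) ℝ
  /-- covariances of the observation noise -/
  V : ∀ i, ℕ → X i → Matrix (Fin (dz i)) (Fin (dz i)) ℝ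
  /-- the control trajectories available to each robot -/
  traj : ∀ i, Finset (Fin K → U i)
  /-- weights of the energy costs -/
  m : Fin n → ℝ
  /-- energy costs of the control trajectories -/
  cost : ∀ i, (Fin K → U i) → ℝ
  /-- upper bound of the energy costs -/
  cmax : ℝ

namespace PlanningProblem

/-- A control trajectory, labelled by the robot that executes it. -/
abbrev Traj (P : PlanningProblem) : Type _ := Σ i : Fin P.n, (Fin P.K → P.U i)

variable (P : PlanningProblem)

/-- The ground set of all available trajectories. -/
def ground : Finset P.Traj := Finset.univ.sigma P.traj

/-- The partition matroid: at most one available trajectory per robot. -/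
def Admissible (S : Finset P.Traj) : Prop :=
  S ⊆ P.ground ∧ ∀ i : Fin P.n, (S.filter (fun σ => σ.1 = i)).card ≤ 1

/-- State at time `k` of the robot that executes the trajectory `σ` (constant after time `K`). -/
def state (σ : P.Traj) : ℕ → P.X σ.1
  | 0 => P.x₀ σ.1
  | k + 1 => if h : k < P.K then P.f σ.1 (state σ k) (σ.2 ⟨k, h⟩) else state σ k

/-- Kalman prediction `Σ ↦ A Σ Aᵀ + W` at time `k`. -/
def predict (k : ℕ) (C : Matrix (Fin P.dy) (Fin P.dy) ℝ) : Matrix (Fin P.dy) (Fin P.dy) ℝ :=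
  P.A k * C * (P.A k)ᵀ + P.W k

/-- Covariance of the target state at time `k` without any measurement. -/
def priorCov : ℕ → Matrix (Fin P.dy) (Fin P.dy) ℝ
  | 0 => P.Sigma₀
  | k + 1 => P.predict k (priorCov k)

/-- Information matrix `Hᵀ V⁻¹ H` of the measurement that is taken at time `k` along `σ`. -/
noncomputable def info (σ : P.Traj) (k : ℕ) : Matrix (Fin P.dy) (Fin P.dy) ℝ :=
  (P.H σ.1 k (P.state σ k))ᵀ * (P.V σ.1 k (P.state σ k))⁻¹ * P.H σ.1 k (P.state σ k)

/-- Kalman measurement update at time `k`, with the measurements along all trajectories in `S`. -/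
noncomputable def update (S : Finset P.Traj) (k : ℕ) (C : Matrix (Fin P.dy) (Fin P.dy) ℝ) :
    Matrix (Fin P.dy) (Fin P.dy) ℝ :=
  (C⁻¹ + ∑ σ ∈ S, P.info σ k)⁻¹

/-- Kalman filter covariance of the target state at time `k`. -/
noncomputable def cov (S : Finset P.Traj) : ℕ → Matrix (Fin P.dy) (Fin P.dy) ℝ
  | 0 => P.Sigma₀
  | k + 1 => P.update S (k + 1) (P.predict k (cov S k))

/-- Mutual information between the target states and the measurements at times `1, …, K`. -/
noncomputable def mutualInfo (S : Finset P.Traj) : ℝ :=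
  (1 / 2) * ∑ k ∈ Finset.Icc 1 P.K,
    (Real.log (P.predict (k - 1) (P.cov S (k - 1))).det - Real.log (P.cov S k).det)

/-- Total weighted energy cost. -/
def energy (S : Finset P.Traj) : ℝ := ∑ σ ∈ S, P.m σ.1 * P.cost σ.1 σ.2

/-- Objective of the planning problem: information gain minus energy cost. -/
noncomputable def J (S : Finset P.Traj) : ℝ := P.mutualInfo S - P.energy S

/-- The constant offset `λ`. -/
def offset : ℝ := ∑ i, P.m i * P.cmax

/-- Offset objective, used as the oracle of the local search. -/
noncomputable def g (S : Finset P.Traj) : ℝ := P.J S + P.offset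

/-- `S` is an optimal solution of the offset problem. -/
def IsOptimal (S : Finset P.Traj) : Prop :=
  P.Admissible S ∧ ∀ S', P.Admissible S' → P.g S' ≤ P.g S

open Classical in
/-- `S` is a solution obtained by the centralized local search with oracle `g`. -/
def IsCLSSolution (α : ℝ) (S : Finset P.Traj) : Prop :=
  LocalSearch.IsOutput P.Admissible P.g α P.ground S

end PlanningProblem

/-! Write the centred target state as `y_k = L k ξ` with one white noise vector `ξ` for all times.
The measurements of `S` up to time `k` give `ξ` the posterior precision `Λ_k = 1 + (a sum over S of
positive semidefinite matrices)`, and the Kalman covariance is `L k Λ_k⁻¹ (L k)ᵀ`. Each increment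
`log det P - log det Σ` equals that of `log det Λ`, so mutual information is `½ log det Λ_K`: zero
at `∅`, monotone and submodular. Energy is additive and at most `λ` on admissible sets; hence `g` is
submodular, and nonnegative there.

At a local optimum `S`, exchanging elements robot by robot with an admissible `C` gives `g (S ∪ C) +
g (S ∩ C) ≤ (2 + α) g S` (`IsRoundResult.union_add_inter_le`). Monotonicity of the information and
`energy S ≤ λ` bound the left side below by `g C`. So the first round alone achieves `2 + α ≤ 4 (1 +
α)`. -/

namespace LocalSearch

/-! ### Approximate local optima of submodular functions on partition matroids. -/

variable {E : Type*} [DecidableEq E]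

/-- Submodularity as diminishing returns. -/
def IsSubmodular (g : Finset E → ℝ) : Prop :=
  ∀ S T a, S ⊆ T → a ∉ T → g (insert a T) - g T ≤ g (insert a S) - g S

theorem IsSubmodular.union_sub_le {g : Finset E → ℝ} (hg : IsSubmodular g) {S D : Finset E}
    (hD : Disjoint D S) : g (S ∪ D) - g S ≤ ∑ a ∈ D, (g (insert a S) - g S) := by
  induction D using Finset.induction_on with
  | empty => simp
  | insert a D ha ih =>
    rw [Finset.disjoint_insert_left] at hD
    rw [Finset.sum_insert ha, Finset.union_insert]
    have h := hg S (S ∪ D) a Finset.subset_union_left (by simp [ha, hD.1])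
    linarith [ih hD.2]

theorem IsSubmodular.sum_sub_erase_le {g : Finset E → ℝ} (hg : IsSubmodular g) {S D : Finset E}
    (hD : D ⊆ S) : ∑ a ∈ D, (g S - g (S.erase a)) ≤ g S - g (S \ D) := by
  induction D using Finset.induction_on with
  | empty => simp
  | insert a D ha ih =>
    rw [Finset.insert_subset_iff] at hD
    rw [Finset.sum_insert ha]
    have h := hg (S \ insert a D) (S.erase a) a
      (fun x hx => by simp at hx ⊢; tauto) (by simp)
    rw [Finset.insert_erase hD.1] at h
    have h2 : insert a (S \ insert a D) = S \ D := by
      ext x; by_cases hxa : x = a <;> simp [hxa, hD.1, ha]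
    rw [h2] at h
    linarith [ih hD.2]

/-- The value of a set at which no deletion, addition or swap gains more than `ε`, over a partition
matroid with parts `p`, compared to any other admissible set. -/
theorem IsSubmodular.union_add_inter_le {ι : Type*} {g : Finset E → ℝ}
    (hg : IsSubmodular g) (p : E → ι) {S C : Finset E} {ε : ℝ}
    (hε₀ : 0 ≤ ε) (hC : Set.InjOn p C)
    (hdel : ∀ s ∈ S, g (S.erase s) ≤ g S + ε)
    (hadd : ∀ c ∈ C \ S, (∀ s ∈ S, p s ≠ p c) → g (insert c S) ≤ g S + ε)
    (hswap : ∀ c ∈ C \ S, ∀ s ∈ S, p s = p c → g (insert c (S.erase s)) ≤ g S + ε) :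
    g (S ∪ C) + g (S ∩ C) ≤ 2 * g S + ((C \ S).card + (S \ C).card) * ε := by
  classical
  have hε : ∀ s ∈ S \ C, 0 ≤ g S - g (S.erase s) + ε := fun s hs => by
    linarith [hdel s (Finset.mem_sdiff.1 hs).1]
  have hU := hg.union_sub_le (S := S) (D := C \ S) Finset.sdiff_disjoint
  have hI := hg.sum_sub_erase_le (S := S) (D := S \ C) Finset.sdiff_subset
  rw [Finset.union_sdiff_self_eq_union] at hU
  rw [Finset.sdiff_sdiff_self_left] at hI
  -- Charge the gain of `c` to the loss from removing its partner `s` in the same part. Partners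
  -- outside the filter cost nothing, as deletion optimality makes every bracket nonnegative.
  have hc : ∀ c ∈ C \ S, g (insert c S) - g S ≤
      (∑ s ∈ (S \ C).filter (fun s => p s = p c), (g S - g (S.erase s) + ε)) + ε := by
    intro c hc
    obtain ⟨hcC, hcS⟩ := Finset.mem_sdiff.1 hc
    by_cases h : ∃ s ∈ S, p s = p c
    · obtain ⟨s, hs, hsc⟩ := h
      have hsC : s ∉ C := fun hsC => hcS (hC hsC hcC hsc ▸ hs)
      have h1 : g S - g (S.erase s) + ε ≤
          ∑ s ∈ (S \ C).filter (fun s => p s = p c), (g S - g (S.erase s) + ε) :=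
        Finset.single_le_sum (f := fun s => g S - g (S.erase s) + ε)
          (fun t ht => hε t (Finset.mem_filter.1 ht).1) (by simp [hs, hsC, hsc])
      have h2 := hg (S.erase s) S c (Finset.erase_subset _ _) hcS
      have h3 := hswap c hc s hs hsc
      linarith
    · push Not at h
      have h1 := hadd c hc h
      have h2 := Finset.sum_nonneg (s := (S \ C).filter (fun s => p s = p c))
        (f := fun s => g S - g (S.erase s) + ε) (fun t ht => hε t (Finset.mem_filter.1 ht).1)
      linarith
  -- `C` has at most one element per part, so no `s` is charged twice.
  have hsum : ∑ c ∈ C \ S, ∑ s ∈ (S \ C).filter (fun s => p s = p c),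
      (g S - g (S.erase s) + ε) ≤ ∑ s ∈ S \ C, (g S - g (S.erase s) + ε) := by
    simp_rw [Finset.sum_filter]
    rw [Finset.sum_comm]
    refine Finset.sum_le_sum fun s hs => ?_
    rw [← Finset.sum_filter, Finset.sum_const, nsmul_eq_mul]
    refine mul_le_of_le_one_left (hε s hs) ?_
    rw [Nat.cast_le_one, Finset.card_le_one]
    intro a ha b hb
    simp only [Finset.mem_filter, Finset.mem_sdiff] at ha hb
    exact hC ha.1.1 hb.1.1 (ha.2.symm.trans hb.2)
  have htot := Finset.sum_le_sum hc
  rw [Finset.sum_add_distrib, Finset.sum_const, nsmul_eq_mul] at htot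
  rw [Finset.sum_add_distrib (s := S \ C), Finset.sum_const, nsmul_eq_mul] at hsum
  rw [Finset.inter_comm] at hI ⊢
  linarith

theorem LocalOp.subset {M S S' : Finset E} (h : LocalOp M S S') (hS : S ⊆ M) : S' ⊆ M := by
  rcases h with ⟨d, -, rfl⟩ | ⟨a, ha, rfl⟩ | ⟨d, -, a, ha, rfl⟩
  · exact (Finset.erase_subset _ _).trans hS
  · exact Finset.insert_subset (Finset.mem_sdiff.1 ha).1 hS
  · exact Finset.insert_subset (Finset.mem_sdiff.1 ha).1 ((Finset.erase_subset _ _).trans hS)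

theorem IsRoundResult.adm {adm : Finset E → Prop} {g : Finset E → ℝ} {α : ℝ} {N : ℕ}
    {M S : Finset E} (h₀ : adm ∅) (h₁ : ∀ a ∈ M, adm {a})
    (h : IsRoundResult adm g α N M S) : adm S := by
  obtain ⟨S₀, hi, hr, -⟩ := h
  rcases hr.cases_tail with rfl | ⟨T, -, hT⟩
  · rcases hi with ⟨-, rfl⟩ | ⟨a, ha, rfl, -⟩
    exacts [h₀, h₁ a ha]
  · exact hT.2.1

/-- From an admissible set of positive value, the while loop can terminate. -/
theorem exists_reflTransGen_step_of_pos {adm : Finset E → Prop} {g : Finset E → ℝ} {α : ℝ}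
    {N : ℕ} {M S : Finset E} (hα : 0 < α) (hN : 0 < N) (hS : S ⊆ M) (hg : 0 < g S) :
    ∃ T, Relation.ReflTransGen (Step adm g α N M) S T ∧ ∀ T', ¬ Step adm g α N M T T' := by
  have hδ : 0 < α / (N : ℝ) ^ 4 := by positivity
  let R : Set (Finset E) := {T | Relation.ReflTransGen (Step adm g α N M) S T}
  have hR : R ⊆ (M.powerset : Set (Finset E)) := by
    intro T hT
    rw [Finset.mem_coe, Finset.mem_powerset]
    induction hT with
    | refl => exact hS
    | tail _ h ih => exact h.1.subset ih
  -- A reachable set of largest value is final: its value is positive, so a further step would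
  -- strictly increase it.
  obtain ⟨T, hT, hmax⟩ := Set.exists_max_image R g
    ((Finset.finite_toSet _).subset hR) ⟨S, Relation.ReflTransGen.refl⟩
  refine ⟨T, hT, fun T' h => ?_⟩
  have h1 := hmax T' (Relation.ReflTransGen.tail hT h)
  have h2 := hmax S Relation.ReflTransGen.refl
  have h3 := mul_pos hδ (hg.trans_le h2)
  have h4 := h.2.2
  linarith

theorem not_step_empty {adm : Finset E → Prop} {g : Finset E → ℝ} {α : ℝ} {N : ℕ}
    (S' : Finset E) : ¬ Step adm g α N ∅ ∅ S' := by
  rintro ⟨h, -⟩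
  simp [LocalOp] at h

/-- A round can terminate if `∅` or every singleton has positive value. -/
theorem exists_isRoundResult {adm : Finset E → Prop} {g : Finset E → ℝ} {α : ℝ}
    {N : ℕ} {M : Finset E} (hα : 0 < α) (hN : M.card ≤ N) (h₀ : adm ∅)
    (hnn : ∀ a ∈ M, 0 ≤ g {a}) (hpos : 0 < g ∅ ∨ ∀ a ∈ M, 0 < g {a}) :
    ∃ S, IsRoundResult adm g α N M S := by
  rcases M.eq_empty_or_nonempty with rfl | hM
  · exact ⟨∅, ∅, Or.inl ⟨rfl, rfl⟩, Relation.ReflTransGen.refl, not_step_empty⟩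
  obtain ⟨a, ha, hmax⟩ := M.exists_max_image (fun a => g {a}) hM
  have hN' : 0 < N := (Finset.card_pos.2 hM).trans_le hN
  have hinit : IsInit g M {a} := Or.inr ⟨a, ha, rfl, hmax⟩
  rcases (hnn a ha).lt_or_eq with h | h
  · obtain ⟨T, hT, hend⟩ := exists_reflTransGen_step_of_pos (adm := adm) hα hN'
      (Finset.singleton_subset_iff.2 ha) h
    exact ⟨T, {a}, hinit, hT, hend⟩
  -- At value zero the threshold factor is void and runs may cycle. Deleting the only element is
  -- then a legal step, and it leads to the positive value `g ∅`.
  · have hpos' : 0 < g ∅ := hpos.resolve_right fun h' => (h' a ha).ne h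
    obtain ⟨T, hT, hend⟩ := exists_reflTransGen_step_of_pos (adm := adm) hα hN'
      (Finset.empty_subset M) hpos'
    refine ⟨T, {a}, hinit, Relation.ReflTransGen.head ⟨?_, h₀, ?_⟩ hT, hend⟩
    · exact Or.inl ⟨a, by simp, by simp⟩
    · rw [← h, mul_zero]
      exact hpos'.le

theorem exists_isOutput {adm : Finset E → Prop} {g : Finset E → ℝ} {α : ℝ} {M : Finset E}
    (hα : 0 < α) (h₀ : adm ∅) (hnn : ∀ a ∈ M, 0 ≤ g {a})
    (hpos : 0 < g ∅ ∨ ∀ a ∈ M, 0 < g {a}) : ∃ S, IsOutput adm g α M S := by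
  obtain ⟨S₁, h₁⟩ := exists_isRoundResult (N := M.card) hα le_rfl h₀ hnn hpos
  have hsub : M \ S₁ ⊆ M := Finset.sdiff_subset
  obtain ⟨S₂, h₂⟩ := exists_isRoundResult (N := M.card) hα (Finset.card_le_card hsub) h₀
    (fun a ha => hnn a (hsub ha)) (hpos.imp id fun h a ha => h a (hsub ha))
  rcases le_total (g S₂) (g S₁) with h | h
  · exact ⟨S₁, S₁, S₂, h₁, h₂, Or.inl ⟨rfl, h⟩⟩
  · exact ⟨S₂, S₁, S₂, h₁, h₂, Or.inr ⟨rfl, h⟩⟩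

theorem IsOutput.adm {adm : Finset E → Prop} {g : Finset E → ℝ} {α : ℝ} {M S : Finset E}
    (h₀ : adm ∅) (h₁ : ∀ a ∈ M, adm {a}) (h : IsOutput adm g α M S) : adm S := by
  obtain ⟨S₁, S₂, hS₁, hS₂, ⟨rfl, -⟩ | ⟨rfl, -⟩⟩ := h
  · exact hS₁.adm h₀ h₁
  · exact hS₂.adm h₀ fun a ha => h₁ a (Finset.sdiff_subset ha)

theorem IsOutput.exists_isRoundResult_le {adm : Finset E → Prop} {g : Finset E → ℝ} {α : ℝ}
    {M S : Finset E} (h : IsOutput adm g α M S) :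
    ∃ S₁, IsRoundResult adm g α M.card M S₁ ∧ g S₁ ≤ g S := by
  obtain ⟨S₁, S₂, hS₁, hS₂, ⟨rfl, -⟩ | ⟨rfl, h⟩⟩ := h
  exacts [⟨_, hS₁, le_rfl⟩, ⟨_, hS₁, h⟩]

/-- Quality of the result of a round for a submodular oracle on a partition matroid. -/
theorem IsRoundResult.union_add_inter_le {ι : Type*} {p : E → ι}
    {adm : Finset E → Prop} {g : Finset E → ℝ} {α : ℝ} {M S C : Finset E}
    (hadm : ∀ T, adm T ↔ T ⊆ M ∧ Set.InjOn p T) (hα : 0 ≤ α) (hg : IsSubmodular g)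
    (h : IsRoundResult adm g α M.card M S) (hS : adm S) (hSnn : 0 ≤ g S) (hC : adm C) :
    g (S ∪ C) + g (S ∩ C) ≤ (2 + α) * g S := by
  obtain ⟨-, -, -, hend⟩ := h
  rw [hadm] at hS hC
  have hloc : ∀ S', LocalOp M S S' → Set.InjOn p S' →
      g S' ≤ g S + α / (M.card : ℝ) ^ 4 * g S := by
    intro S' hop hinj
    by_contra hlt
    exact hend S' ⟨hop, (hadm S').2 ⟨hop.subset hS.1, hinj⟩, by linarith⟩
  have hmem : ∀ c ∈ C \ S, c ∈ M \ S := fun c hc =>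
    Finset.sdiff_subset_sdiff hC.1 le_rfl hc
  have key := hg.union_add_inter_le p (S := S) (C := C) (ε := α / (M.card : ℝ) ^ 4 * g S)
    (by positivity) hC.2
    (fun s hs => hloc _ (Or.inl ⟨s, hs, rfl⟩) (hS.2.mono (by simp)))
    (fun c hc hne => hloc _ (Or.inr (Or.inl ⟨c, hmem c hc, rfl⟩)) (by
      rw [Finset.coe_insert, Set.injOn_insert (by simpa using (Finset.mem_sdiff.1 hc).2)]
      refine ⟨hS.2, ?_⟩
      rintro ⟨s, hs, hsc⟩
      exact hne s hs hsc))
    (fun c hc s hs hsc => hloc _ (Or.inr (Or.inr ⟨s, hs, c, hmem c hc, rfl⟩)) (by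
      rw [Finset.coe_insert, Set.injOn_insert (by
        have := (Finset.mem_sdiff.1 hc).2
        simp [this])]
      refine ⟨hS.2.mono (by simp), ?_⟩
      rintro ⟨t, ht, htc⟩
      rw [Finset.mem_coe, Finset.mem_erase] at ht
      exact ht.1 (hS.2 ht.2 hs (htc.trans hsc.symm))))
  have hcard : (C \ S).card + (S \ C).card ≤ M.card := by
    rw [← Finset.card_union_of_disjoint disjoint_sdiff_sdiff]
    exact Finset.card_le_card (Finset.union_subset (Finset.sdiff_subset.trans hC.1)
      (Finset.sdiff_subset.trans hS.1))
  -- At most `N` exchange errors occur, each `α / N ^ 4 * g S`. For `N = 0` the quotient is `0` by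
  -- convention.
  have hN : (M.card : ℝ) * (α / (M.card : ℝ) ^ 4) ≤ α := by
    rcases Nat.eq_zero_or_pos M.card with h0 | h0
    · simpa [h0] using hα
    · have h1 : (1 : ℝ) ≤ M.card := by exact_mod_cast h0
      rw [← mul_div_assoc, div_le_iff₀ (by positivity), mul_comm]
      gcongr
      exact le_self_pow₀ h1 (by norm_num)
  have h2 : ((C \ S).card + (S \ C).card : ℝ) ≤ M.card := by exact_mod_cast hcard
  have h3 : ((C \ S).card + (S \ C).card : ℝ) * (α / (M.card : ℝ) ^ 4 * g S) ≤ α * g S := by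
    rw [← mul_assoc]
    refine mul_le_mul_of_nonneg_right (le_trans ?_ hN) hSnn
    gcongr
  linarith

end LocalSearch

/-! ### Determinants of positive definite matrices -/

namespace Matrix

open scoped MatrixOrder

variable {d e : Type*} [Fintype d] [Fintype e]

theorem PosSemidef.exists_eq_mul_transpose {B : Matrix d d ℝ} (hB : B.PosSemidef) :
    ∃ R : Matrix d d ℝ, R * Rᵀ = B := by
  classical
  obtain ⟨C, rfl⟩ := CStarAlgebra.nonneg_iff_eq_star_mul_self.1 (nonneg_iff_posSemidef.2 hB)
  exact ⟨Cᵀ, by rw [transpose_transpose, star_eq_conjTranspose,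
    conjTranspose_eq_transpose_of_trivial]⟩

theorem PosSemidef.transpose_mul_mul {B : Matrix d d ℝ} (hB : B.PosSemidef) (C : Matrix d e ℝ) :
    (Cᵀ * B * C).PosSemidef := by
  simpa [conjTranspose_eq_transpose_of_trivial] using hB.conjTranspose_mul_mul_same C

theorem PosSemidef.one_le_det_one_add [DecidableEq d] {B : Matrix d d ℝ} (hB : B.PosSemidef) :
    1 ≤ (1 + B).det := by
  -- `det (1 + B)` is the characteristic polynomial of `-B` at `1`, and the eigenvalues of `-B` are
  -- nonpositive.
  have hN : (-B).IsHermitian := hB.isHermitian.neg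
  have h : (1 + B).det = ∏ i, (1 - hN.eigenvalues i) := by
    have := congrArg (Polynomial.eval 1) hN.charpoly_eq
    rw [eval_charpoly, Polynomial.eval_prod] at this
    simpa using this
  rw [h]
  refine Finset.one_le_prod fun i _ => ?_
  have h1 := hN.eigenvalues_eq i
  have h2 := hB.dotProduct_mulVec_nonneg (hN.eigenvectorBasis i : d → ℝ)
  simp only [neg_mulVec, dotProduct_neg, RCLike.re_to_real] at h1
  linarith

variable [DecidableEq d]

theorem PosDef.det_le_det_add {X D : Matrix d d ℝ} (hX : X.PosDef) (hD : D.PosSemidef) :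
    X.det ≤ (X + D).det := by
  obtain ⟨R, rfl⟩ := hD.exists_eq_mul_transpose
  have hu : IsUnit X.det := hX.det_pos.ne'.isUnit
  rw [det_add_mul R Rᵀ hu]
  have h : (Rᵀ * X⁻¹ * R).PosSemidef := hX.inv.posSemidef.transpose_mul_mul R
  exact le_mul_of_one_le_right hX.det_pos.le h.one_le_det_one_add

/-- With `Y = X + D`, the difference is the congruence `Y⁻¹ (D + D X⁻¹ D) Y⁻¹`. -/
theorem PosDef.inv_sub_inv_add {X D : Matrix d d ℝ} (hX : X.PosDef) (hD : D.PosSemidef) :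
    (X⁻¹ - (X + D)⁻¹).PosSemidef := by
  have hY := hX.add_posSemidef hD
  set Y := X + D with hYdef
  have hXu : IsUnit X.det := hX.det_pos.ne'.isUnit
  have hYu : IsUnit Y.det := hY.det_pos.ne'.isUnit
  have hYt : (Y⁻¹)ᵀ = Y⁻¹ := by
    rw [← conjTranspose_eq_transpose_of_trivial]; exact hY.inv.isHermitian
  have hDt : Dᵀ = D := by
    rw [← conjTranspose_eq_transpose_of_trivial]; exact hD.isHermitian
  have key : X⁻¹ - Y⁻¹ = (Y⁻¹)ᵀ * (D + Dᵀ * X⁻¹ * D) * Y⁻¹ := by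
    have h1 : D + Dᵀ * X⁻¹ * D = D * X⁻¹ * Y := by
      rw [hYdef, Matrix.mul_add, Matrix.mul_assoc D X⁻¹ X, nonsing_inv_mul _ hXu, mul_one, hDt]
    have h2 : D = Y - X := by rw [hYdef, add_sub_cancel_left]
    rw [h1, hYt, Matrix.mul_assoc, Matrix.mul_assoc _ Y, mul_nonsing_inv _ hYu, mul_one, h2,
      Matrix.sub_mul, mul_nonsing_inv _ hXu, Matrix.mul_sub, ← Matrix.mul_assoc,
      nonsing_inv_mul _ hYu, one_mul, mul_one]
  rw [key]
  exact (hD.add (hX.inv.posSemidef.transpose_mul_mul D)).transpose_mul_mul _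

/-- Source of submodularity: for `B = R Rᵀ`, the ratio `det (X + B) / det X = det (1 + Rᵀ X⁻¹ R)`
cannot grow when `X` is replaced by `X + D`, because inversion reverses the order. -/
theorem PosDef.det_add_add_mul_det_le {X B D : Matrix d d ℝ} (hX : X.PosDef) (hB : B.PosSemidef)
    (hD : D.PosSemidef) : (X + D + B).det * X.det ≤ (X + D).det * (X + B).det := by
  obtain ⟨R, rfl⟩ := hB.exists_eq_mul_transpose
  have hY := hX.add_posSemidef hD
  rw [det_add_mul R Rᵀ hX.det_pos.ne'.isUnit, det_add_mul R Rᵀ hY.det_pos.ne'.isUnit]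
  have h1 : (1 + Rᵀ * (X + D)⁻¹ * R).PosDef :=
    PosDef.one.add_posSemidef (hY.inv.posSemidef.transpose_mul_mul R)
  have h2 := h1.det_le_det_add ((hX.inv_sub_inv_add hD).transpose_mul_mul R)
  have h3 : 1 + Rᵀ * (X + D)⁻¹ * R + Rᵀ * (X⁻¹ - (X + D)⁻¹) * R = 1 + Rᵀ * X⁻¹ * R := by
    rw [Matrix.mul_sub, Matrix.sub_mul]; abel
  rw [h3] at h2
  nlinarith [mul_le_mul_of_nonneg_left h2 (mul_pos hY.det_pos hX.det_pos).le]

end Matrix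

/-! ### The Kalman filter as inference of a white noise vector -/

namespace PlanningProblem

variable (P : PlanningProblem)

/-- Standing assumptions on the Gaussian target model and the sensors. -/
structure IsRegular : Prop where
  Sigma₀ : P.Sigma₀.PosSemidef
  W : ∀ k < P.K, (P.W k).PosSemidef
  prior : ∀ k, 1 ≤ k → k ≤ P.K → (P.priorCov k).PosDef
  V : ∀ i k x, 1 ≤ k → k ≤ P.K → (P.V i k x).PosDef

/-- Index set of a white noise vector that drives the initial state and the target motion. -/
abbrev NoiseIdx : Type := Fin (P.K + 1) × Fin P.dy

/-- `L k` represents the target state at time `k` as a linear function of a white noise vector. -/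
structure IsWhitening (L : ℕ → Matrix (Fin P.dy) P.NoiseIdx ℝ) : Prop where
  zero : L 0 * (L 0)ᵀ = P.Sigma₀
  succ : ∀ k < P.K, ∃ N, L (k + 1) = P.A k * L k + N ∧ N * Nᵀ = P.W k ∧ ∀ j ≤ k, L j * Nᵀ = 0

/-- Selects block `j` of the white noise vector. -/
def noiseBlock (j : ℕ) : Matrix (Fin P.dy) P.NoiseIdx ℝ :=
  Matrix.of fun a q => if q.1.val = j ∧ q.2 = a then 1 else 0

variable {P}

theorem noiseBlock_mul_transpose_self {j : ℕ} (hj : j ≤ P.K) :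
    P.noiseBlock j * (P.noiseBlock j)ᵀ = 1 := by
  ext a b
  rw [Matrix.mul_apply, Fintype.sum_prod_type, Finset.sum_eq_single ⟨j, Nat.lt_succ_of_le hj⟩]
  · simp [noiseBlock, Matrix.one_apply, eq_comm]
  · intro i _ hi
    have : i.val ≠ j := fun h => hi (Fin.ext h)
    simp [noiseBlock, this]
  · simp

theorem noiseBlock_mul_transpose_of_ne {i j : ℕ} (hij : i ≠ j) :
    P.noiseBlock i * (P.noiseBlock j)ᵀ = 0 := by
  ext a b
  rw [Matrix.mul_apply]
  refine Finset.sum_eq_zero fun q _ => ?_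
  simp only [noiseBlock, Matrix.of_apply, Matrix.transpose_apply]
  by_cases h : q.1.val = i
  · have : q.1.val ≠ j := h ▸ hij
    simp [this]
  · simp [h]

/-- Block `0` drives the initial state and block `k + 1` the motion noise at time `k`, through
square roots of the covariances; these may be singular. -/
theorem IsRegular.exists_isWhitening (h : P.IsRegular) : ∃ L, P.IsWhitening L := by
  obtain ⟨R₀, hR₀⟩ := h.Sigma₀.exists_eq_mul_transpose
  have hR : ∀ k, ∃ R : Matrix (Fin P.dy) (Fin P.dy) ℝ, k < P.K → R * Rᵀ = P.W k := by
    intro k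
    by_cases hk : k < P.K
    · obtain ⟨R, hR⟩ := (h.W k hk).exists_eq_mul_transpose
      exact ⟨R, fun _ => hR⟩
    · exact ⟨0, fun h => absurd h hk⟩
  choose R hR using hR
  let L : ℕ → Matrix (Fin P.dy) P.NoiseIdx ℝ := fun k =>
    Nat.rec (R₀ * P.noiseBlock 0) (fun k Lk => P.A k * Lk + R k * P.noiseBlock (k + 1)) k
  have hsucc : ∀ k, L (k + 1) = P.A k * L k + R k * P.noiseBlock (k + 1) := fun k => rfl
  have horth : ∀ j k, j < k → L j * (P.noiseBlock k)ᵀ = 0 := by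
    intro j
    induction j with
    | zero =>
      intro k hk
      rw [show L 0 = R₀ * P.noiseBlock 0 from rfl, Matrix.mul_assoc,
        noiseBlock_mul_transpose_of_ne hk.ne, Matrix.mul_zero]
    | succ j ih =>
      intro k hk
      rw [hsucc, Matrix.add_mul, Matrix.mul_assoc, ih k (by omega), Matrix.mul_assoc,
        noiseBlock_mul_transpose_of_ne hk.ne, Matrix.mul_zero, Matrix.mul_zero, add_zero]
  refine ⟨L, ?_, fun k hk => ⟨R k * P.noiseBlock (k + 1), hsucc k, ?_, fun j hj => ?_⟩⟩
  · rw [show L 0 = R₀ * P.noiseBlock 0 from rfl, Matrix.transpose_mul, Matrix.mul_assoc,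
      ← Matrix.mul_assoc _ _ R₀ᵀ, noiseBlock_mul_transpose_self (Nat.zero_le _), Matrix.one_mul,
      hR₀]
  · rw [Matrix.transpose_mul, Matrix.mul_assoc, ← Matrix.mul_assoc _ _ (R k)ᵀ,
      noiseBlock_mul_transpose_self hk, Matrix.one_mul, hR k hk]
  · rw [Matrix.transpose_mul, ← Matrix.mul_assoc, horth j _ (by omega), Matrix.zero_mul]

theorem IsWhitening.mul_transpose_eq_priorCov {L : ℕ → Matrix (Fin P.dy) P.NoiseIdx ℝ}
    (hL : P.IsWhitening L) : ∀ k ≤ P.K, L k * (L k)ᵀ = P.priorCov k := by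
  intro k
  induction k with
  | zero => exact fun _ => hL.zero
  | succ k ih =>
    intro hk
    obtain ⟨N, h1, h2, h3⟩ := hL.succ k hk
    have h4 : N * (L k)ᵀ = 0 := by
      rw [← Matrix.transpose_transpose N, ← Matrix.transpose_mul, h3 k le_rfl,
        Matrix.transpose_zero]
    simp only [priorCov, predict, ← ih (by omega), h1, Matrix.transpose_add, Matrix.transpose_mul,
      Matrix.add_mul, Matrix.mul_add, h2]
    rw [Matrix.mul_assoc (P.A k) (L k) Nᵀ, h3 k le_rfl, ← Matrix.mul_assoc N, h4]
    simp [Matrix.mul_assoc]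

/-- Information about the white noise vector from the measurements of `σ` at times `1, …, k`. -/
noncomputable def noiseInfo (L : ℕ → Matrix (Fin P.dy) P.NoiseIdx ℝ) (k : ℕ) (σ : P.Traj) :
    Matrix P.NoiseIdx P.NoiseIdx ℝ :=
  ∑ j ∈ Finset.Icc 1 k, (L j)ᵀ * P.info σ j * L j

/-- Posterior information matrix of the white noise vector at time `k`. -/
noncomputable def noisePrecision (L : ℕ → Matrix (Fin P.dy) P.NoiseIdx ℝ) (S : Finset P.Traj)
    (k : ℕ) : Matrix P.NoiseIdx P.NoiseIdx ℝ :=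
  1 + ∑ σ ∈ S, noiseInfo L k σ

theorem IsRegular.posSemidef_info (h : P.IsRegular) (σ : P.Traj) {k : ℕ} (h1 : 1 ≤ k)
    (hk : k ≤ P.K) : (P.info σ k).PosSemidef :=
  (h.V σ.1 k (P.state σ k) h1 hk).inv.posSemidef.transpose_mul_mul _

theorem IsRegular.posSemidef_noiseInfo (h : P.IsRegular)
    (L : ℕ → Matrix (Fin P.dy) P.NoiseIdx ℝ) {k : ℕ} (hk : k ≤ P.K) (σ : P.Traj) :
    (noiseInfo L k σ).PosSemidef := by
  refine Matrix.posSemidef_sum _ fun j hj => ?_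
  rw [Finset.mem_Icc] at hj
  exact (h.posSemidef_info σ hj.1 (hj.2.trans hk)).transpose_mul_mul _

theorem IsRegular.posDef_noisePrecision (h : P.IsRegular)
    (L : ℕ → Matrix (Fin P.dy) P.NoiseIdx ℝ) (S : Finset P.Traj) {k : ℕ} (hk : k ≤ P.K) :
    (noisePrecision L S k).PosDef :=
  Matrix.PosDef.one.add_posSemidef
    (Matrix.posSemidef_sum _ fun σ _ => h.posSemidef_noiseInfo L hk σ)

theorem noisePrecision_succ (L : ℕ → Matrix (Fin P.dy) P.NoiseIdx ℝ) (S : Finset P.Traj)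
    (k : ℕ) : noisePrecision L S (k + 1) =
      noisePrecision L S k + (L (k + 1))ᵀ * (∑ σ ∈ S, P.info σ (k + 1)) * L (k + 1) := by
  simp only [noisePrecision, noiseInfo, Finset.sum_Icc_succ_top (Nat.le_add_left 1 k),
    Finset.sum_add_distrib, Matrix.mul_sum, Matrix.sum_mul, add_assoc]

theorem IsWhitening.predict_eq (h : P.IsRegular) {L : ℕ → Matrix (Fin P.dy) P.NoiseIdx ℝ}
    (hL : P.IsWhitening L) (S : Finset P.Traj) {k : ℕ} (hk : k < P.K) :
    P.predict k (L k * (noisePrecision L S k)⁻¹ * (L k)ᵀ) =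
      L (k + 1) * (noisePrecision L S k)⁻¹ * (L (k + 1))ᵀ := by
  obtain ⟨N, h1, h2, h3⟩ := hL.succ k hk
  set Λ := noisePrecision L S k with hΛ
  have hpd : Λ.PosDef := h.posDef_noisePrecision L S hk.le
  -- Measurements up to time `k` say nothing about the fresh noise, so `Λ` acts as the identity on
  -- it and the cross terms vanish.
  have hN : Λ * Nᵀ = Nᵀ := by
    rw [hΛ, noisePrecision, Matrix.add_mul, Matrix.one_mul, Matrix.sum_mul, Finset.sum_eq_zero,
      add_zero]
    intro σ _
    rw [noiseInfo, Matrix.sum_mul]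
    refine Finset.sum_eq_zero fun j hj => ?_
    rw [Matrix.mul_assoc, h3 j (Finset.mem_Icc.1 hj).2, Matrix.mul_zero]
  have hN' : Λ⁻¹ * Nᵀ = Nᵀ := by
    conv_lhs => rw [← hN]
    rw [← Matrix.mul_assoc, Matrix.nonsing_inv_mul _ hpd.det_pos.ne'.isUnit, Matrix.one_mul]
  have hΛt : (Λ⁻¹)ᵀ = Λ⁻¹ := by
    rw [← Matrix.conjTranspose_eq_transpose_of_trivial]
    exact hpd.inv.isHermitian
  have h5 : N * Λ⁻¹ * (L k)ᵀ = 0 := by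
    rw [← Matrix.transpose_eq_zero, Matrix.transpose_mul, Matrix.transpose_mul,
      Matrix.transpose_transpose, hΛt, hN', h3 k le_rfl]
  rw [predict, h1, Matrix.transpose_add, Matrix.transpose_mul]
  simp only [Matrix.add_mul, Matrix.mul_add]
  have e1 : P.A k * L k * Λ⁻¹ * Nᵀ = 0 := by
    rw [Matrix.mul_assoc, hN', Matrix.mul_assoc, h3 k le_rfl, Matrix.mul_zero]
  have e2 : N * Λ⁻¹ * Nᵀ = P.W k := by rw [Matrix.mul_assoc, hN', h2]
  rw [e1, e2, ← Matrix.mul_assoc (N * Λ⁻¹), h5]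
  simp [Matrix.mul_assoc]

/-- A positive definite prior `L k (L k)ᵀ` forces `L k` to have independent rows. This makes the
predicted covariances truly invertible. -/
theorem IsWhitening.posDef_mul_mul_transpose (h : P.IsRegular) {L : ℕ → Matrix (Fin P.dy) P.NoiseIdx ℝ}
    (hL : P.IsWhitening L) {Q : Matrix P.NoiseIdx P.NoiseIdx ℝ} (hQ : Q.PosDef) {k : ℕ}
    (h1 : 1 ≤ k) (hk : k ≤ P.K) : (L k * Q * (L k)ᵀ).PosDef := by
  have hp := h.prior k h1 hk
  rw [← hL.mul_transpose_eq_priorCov k hk] at hp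
  have hinj : Function.Injective (L k).vecMul := by
    intro x y hxy
    have : Function.Injective (L k * (L k)ᵀ).vecMul :=
      Matrix.vecMul_injective_of_isUnit hp.isUnit
    apply this
    simp only [← Matrix.vecMul_vecMul] at hxy ⊢
    exact congrArg (fun v => Matrix.vecMul v (L k)ᵀ) hxy
  simpa [Matrix.conjTranspose_eq_transpose_of_trivial] using hQ.mul_mul_conjTranspose_same hinj

end PlanningProblem

namespace Matrix

/-- Measurement update in information form, pushed through the linear map `L`. -/
theorem inv_add_inv_of_mul_mul_transpose {d e : Type*} [Fintype d] [DecidableEq d] [Fintype e]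
    [DecidableEq e] {X : Matrix e e ℝ} {L : Matrix d e ℝ} {M : Matrix d d ℝ}
    (hX : IsUnit X.det) (hY : IsUnit (X + Lᵀ * M * L).det) (hP : IsUnit (L * X⁻¹ * Lᵀ).det) :
    ((L * X⁻¹ * Lᵀ)⁻¹ + M)⁻¹ = L * (X + Lᵀ * M * L)⁻¹ * Lᵀ := by
  set Y := X + Lᵀ * M * L with hYdef
  set C := L * X⁻¹ * Lᵀ with hC
  -- Resolvent identity; compressed by `L` it becomes `C = (L Y⁻¹ Lᵀ) (1 + M C)`, which exhibits the
  -- inverse.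
  have h1 : X⁻¹ = Y⁻¹ + Y⁻¹ * (Lᵀ * M * L) * X⁻¹ := by
    have : Lᵀ * M * L = Y - X := by rw [hYdef, add_sub_cancel_left]
    rw [this, Matrix.mul_sub, Matrix.sub_mul, nonsing_inv_mul _ hY, Matrix.mul_assoc,
      mul_nonsing_inv _ hX, Matrix.one_mul, Matrix.mul_one, add_sub_cancel]
  have h2 : C = L * Y⁻¹ * Lᵀ * (1 + M * C) := by
    rw [Matrix.mul_add, Matrix.mul_one, hC]
    conv_lhs => rw [h1]
    simp only [Matrix.mul_add, Matrix.add_mul, Matrix.mul_assoc]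
  refine inv_eq_left_inv ?_
  have h3 : C⁻¹ + M = (1 + M * C) * C⁻¹ := by
    rw [Matrix.add_mul, Matrix.one_mul, Matrix.mul_assoc, mul_nonsing_inv _ hP, Matrix.mul_one]
  rw [h3, ← Matrix.mul_assoc, ← h2, mul_nonsing_inv _ hP]

/-- By Sylvester's identity, both sides are `det X * det (1 + M L X⁻¹ Lᵀ)`. -/
theorem det_mul_det_inv_add {d e : Type*} [Fintype d] [DecidableEq d] [Fintype e]
    [DecidableEq e] {X : Matrix e e ℝ} {L : Matrix d e ℝ} {M : Matrix d d ℝ}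
    (hX : IsUnit X.det) (hP : IsUnit (L * X⁻¹ * Lᵀ).det) :
    (L * X⁻¹ * Lᵀ).det * ((L * X⁻¹ * Lᵀ)⁻¹ + M).det * X.det = (X + Lᵀ * M * L).det := by
  rw [← det_mul, Matrix.mul_add, mul_nonsing_inv _ hP, det_add_mul (Lᵀ * M) L hX,
    det_one_add_mul_comm, mul_comm]
  simp only [Matrix.mul_assoc]
  rw [det_one_add_mul_comm]
  simp only [Matrix.mul_assoc]

end Matrix

/-! ### Mutual information as a log-determinant of the noise precision. -/

namespace PlanningProblem

variable {P : PlanningProblem}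

theorem IsWhitening.cov_eq (h : P.IsRegular) {L : ℕ → Matrix (Fin P.dy) P.NoiseIdx ℝ}
    (hL : P.IsWhitening L) (S : Finset P.Traj) :
    ∀ k ≤ P.K, P.cov S k = L k * (noisePrecision L S k)⁻¹ * (L k)ᵀ := by
  intro k
  induction k with
  | zero => intro _; simp [cov, noisePrecision, noiseInfo, hL.zero]
  | succ k ih =>
    intro hk
    have hX := h.posDef_noisePrecision L S (Nat.le_of_succ_le hk)
    have hY := h.posDef_noisePrecision L S hk
    have hC := hL.posDef_mul_mul_transpose h hX.inv (Nat.le_add_left 1 k) hk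
    rw [noisePrecision_succ] at hY ⊢
    rw [cov, update, ih (Nat.le_of_succ_le hk), hL.predict_eq h S hk]
    exact Matrix.inv_add_inv_of_mul_mul_transpose hX.det_pos.ne'.isUnit hY.det_pos.ne'.isUnit
      hC.det_pos.ne'.isUnit

theorem IsWhitening.log_det_sub_log_det (h : P.IsRegular)
    {L : ℕ → Matrix (Fin P.dy) P.NoiseIdx ℝ} (hL : P.IsWhitening L) (S : Finset P.Traj) {k : ℕ}
    (hk : k < P.K) :
    Real.log (P.predict k (P.cov S k)).det - Real.log (P.cov S (k + 1)).det =
      Real.log (noisePrecision L S (k + 1)).det - Real.log (noisePrecision L S k).det := by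
  have hX := h.posDef_noisePrecision L S hk.le
  have hY := h.posDef_noisePrecision L S hk
  have hC := hL.posDef_mul_mul_transpose h hX.inv (Nat.le_add_left 1 k) hk
  rw [cov, update, hL.cov_eq h S k hk.le, hL.predict_eq h S hk]
  have hU := hC.inv.add_posSemidef (Matrix.posSemidef_sum S fun σ _ =>
    h.posSemidef_info σ (Nat.le_add_left 1 k) hk)
  have hd := Matrix.det_mul_det_inv_add (M := ∑ σ ∈ S, P.info σ (k + 1)) hX.det_pos.ne'.isUnit
    hC.det_pos.ne'.isUnit
  rw [noisePrecision_succ, ← hd, Real.log_mul (mul_pos hC.det_pos hU.det_pos).ne' hX.det_pos.ne',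
    Real.log_mul hC.det_pos.ne' hU.det_pos.ne', Matrix.det_nonsing_inv, Ring.inverse_eq_inv',
    Real.log_inv]
  ring

theorem IsWhitening.mutualInfo_eq (h : P.IsRegular) {L : ℕ → Matrix (Fin P.dy) P.NoiseIdx ℝ}
    (hL : P.IsWhitening L) (S : Finset P.Traj) :
    P.mutualInfo S = 1 / 2 * Real.log (noisePrecision L S P.K).det := by
  -- The sum telescopes, starting from precision `1` at time `0`.
  have key : ∀ k ≤ P.K, ∑ j ∈ Finset.Icc 1 k,
      (Real.log (P.predict (j - 1) (P.cov S (j - 1))).det - Real.log (P.cov S j).det) =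
        Real.log (noisePrecision L S k).det := by
    intro k
    induction k with
    | zero => intro _; simp [noisePrecision, noiseInfo]
    | succ k ih =>
      intro hk
      rw [Finset.sum_Icc_succ_top (Nat.le_add_left 1 k), ih (Nat.le_of_succ_le hk),
        Nat.add_sub_cancel, hL.log_det_sub_log_det h S hk]
      ring
  rw [mutualInfo, key P.K le_rfl]

open Classical in
theorem IsRegular.isSubmodular_mutualInfo (h : P.IsRegular) :
    LocalSearch.IsSubmodular P.mutualInfo := by
  obtain ⟨L, hL⟩ := h.exists_isWhitening
  intro S T a hST haT
  simp only [hL.mutualInfo_eq h]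
  have haS : a ∉ S := fun ha => haT (hST ha)
  have hins : ∀ R : Finset P.Traj, a ∉ R → noisePrecision L (insert a R) P.K =
      noisePrecision L R P.K + noiseInfo L P.K a := by
    intro R ha
    rw [noisePrecision, Finset.sum_insert ha, noisePrecision]
    abel
  have hTS : noisePrecision L T P.K = noisePrecision L S P.K +
      ∑ σ ∈ T \ S, noiseInfo L P.K σ := by
    rw [noisePrecision, noisePrecision, ← Finset.sum_sdiff hST]
    abel
  have hS := h.posDef_noisePrecision L S le_rfl
  have hSa := h.posDef_noisePrecision L (insert a S) le_rfl
  have hT := h.posDef_noisePrecision L T le_rfl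
  have hTa := h.posDef_noisePrecision L (insert a T) le_rfl
  have hdet := hS.det_add_add_mul_det_le (h.posSemidef_noiseInfo L le_rfl a)
    (Matrix.posSemidef_sum (T \ S) fun σ _ => h.posSemidef_noiseInfo L le_rfl σ)
  rw [← hTS, ← hins S haS, ← hins T haT] at hdet
  have hlog := Real.log_le_log (mul_pos hTa.det_pos hS.det_pos) hdet
  rw [Real.log_mul hTa.det_pos.ne' hS.det_pos.ne',
    Real.log_mul hT.det_pos.ne' hSa.det_pos.ne'] at hlog
  linarith

theorem IsRegular.mutualInfo_mono (h : P.IsRegular) {S T : Finset P.Traj} (hST : S ⊆ T) :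
    P.mutualInfo S ≤ P.mutualInfo T := by
  classical
  obtain ⟨L, hL⟩ := h.exists_isWhitening
  simp only [hL.mutualInfo_eq h]
  have hTS : noisePrecision L T P.K = noisePrecision L S P.K +
      ∑ σ ∈ T \ S, noiseInfo L P.K σ := by
    rw [noisePrecision, noisePrecision, ← Finset.sum_sdiff hST]
    abel
  have hS := h.posDef_noisePrecision L S le_rfl
  have hdet := hS.det_le_det_add
    (Matrix.posSemidef_sum (T \ S) fun σ _ => h.posSemidef_noiseInfo L le_rfl σ)
  rw [← hTS] at hdet
  linarith [Real.log_le_log hS.det_pos hdet]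

theorem IsRegular.mutualInfo_empty (h : P.IsRegular) : P.mutualInfo ∅ = 0 := by
  obtain ⟨L, hL⟩ := h.exists_isWhitening
  simp [hL.mutualInfo_eq h, noisePrecision]

theorem IsRegular.mutualInfo_nonneg (h : P.IsRegular) (S : Finset P.Traj) :
    0 ≤ P.mutualInfo S :=
  h.mutualInfo_empty ▸ h.mutualInfo_mono (Finset.empty_subset S)

/-! ### The offset objective -/

theorem admissible_iff {S : Finset P.Traj} :
    P.Admissible S ↔ S ⊆ P.ground ∧ Set.InjOn Sigma.fst (S : Set P.Traj) := by
  refine and_congr_right fun _ => ?_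
  simp only [Finset.card_le_one, Finset.mem_filter]
  exact ⟨fun h σ hσ τ hτ heq => h τ.1 σ ⟨hσ, heq⟩ τ ⟨hτ, rfl⟩,
    fun h i σ hσ τ hτ => h hσ.1 hτ.1 (hσ.2.trans hτ.2.symm)⟩

theorem admissible_empty : P.Admissible ∅ := by simp [admissible_iff]

theorem admissible_singleton {σ : P.Traj} (hσ : σ ∈ P.ground) : P.Admissible {σ} := by
  simp [admissible_iff, hσ]

theorem Admissible.energy_le_offset {S : Finset P.Traj} (hS : P.Admissible S)
    (hm : ∀ i, 0 ≤ P.m i) (hcmax : 0 ≤ P.cmax)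
    (hcost : ∀ i, ∀ σ ∈ P.traj i, P.cost i σ ≤ P.cmax) : P.energy S ≤ P.offset := by
  rw [admissible_iff] at hS
  calc P.energy S ≤ ∑ σ ∈ S, P.m σ.1 * P.cmax := by
        refine Finset.sum_le_sum fun σ hσ => mul_le_mul_of_nonneg_left ?_ (hm _)
        exact hcost _ _ (Finset.mem_sigma.1 (hS.1 hσ)).2
    _ = ∑ i ∈ S.image Sigma.fst, P.m i * P.cmax := by
        rw [Finset.sum_image fun σ hσ τ hτ heq => hS.2 hσ hτ heq]
    _ ≤ P.offset := Finset.sum_le_sum_of_subset_of_nonneg (Finset.subset_univ _)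
        fun i _ _ => mul_nonneg (hm i) hcmax

open Classical in
theorem IsRegular.isSubmodular_g (h : P.IsRegular) : LocalSearch.IsSubmodular P.g := by
  intro S T a hST haT
  have haS : a ∉ S := fun ha => haT (hST ha)
  have := h.isSubmodular_mutualInfo S T a hST haT
  simp only [g, J, energy, Finset.sum_insert haT, Finset.sum_insert haS]
  linarith

end PlanningProblem

theorem proposition1 (P : PlanningProblem) (α : ℝ) (hα : 0 < α)
    (hSigma₀ : P.Sigma₀.PosSemidef)
    (hW : ∀ k < P.K, (P.W k).PosSemidef)
    (hprior : ∀ k, 1 ≤ k → k ≤ P.K → (P.priorCov k).PosDef)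
    (hV : ∀ i k x, 1 ≤ k → k ≤ P.K → (P.V i k x).PosDef)
    (hm : ∀ i, 0 ≤ P.m i)
    (hcmax : 0 ≤ P.cmax)
    (hcost : ∀ i, ∀ σ ∈ P.traj i, 0 ≤ P.cost i σ ∧ P.cost i σ ≤ P.cmax) :
    (∀ S, P.Admissible S → 0 ≤ P.g S) ∧
    (∀ Sopt Sls, P.IsOptimal Sopt → P.IsCLSSolution α Sls →
      P.Admissible Sls ∧ 0 ≤ P.g Sopt ∧ P.g Sopt ≤ 4 * (1 + α) * P.g Sls) ∧
    ((0 < P.offset ∨ ∀ σ ∈ P.ground, 0 < P.g {σ}) → ∃ Sls, P.IsCLSSolution α Sls) := by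
  classical
  have h : P.IsRegular := ⟨hSigma₀, hW, hprior, hV⟩
  have henergy : ∀ S, P.Admissible S → P.energy S ≤ P.offset := fun S hS =>
    hS.energy_le_offset hm hcmax fun i σ hσ => (hcost i σ hσ).2
  have hnn : ∀ S, P.Admissible S → 0 ≤ P.g S := by
    intro S hS
    have h1 := h.mutualInfo_nonneg S
    have h2 := henergy S hS
    simp only [PlanningProblem.g, PlanningProblem.J]
    linarith
  have hsingle : ∀ σ ∈ P.ground, P.Admissible {σ} := fun σ hσ =>
    PlanningProblem.admissible_singleton hσ
  refine ⟨hnn, fun Sopt Sls hopt hls => ?_, fun hpos => ?_⟩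
  · have hadm : P.Admissible Sls := hls.adm PlanningProblem.admissible_empty hsingle
    refine ⟨hadm, hnn _ hopt.1, ?_⟩
    obtain ⟨S₁, hS₁, hle⟩ := hls.exists_isRoundResult_le
    have hadm₁ := hS₁.adm PlanningProblem.admissible_empty hsingle
    have hnn₁ := hnn _ hadm₁
    have key := hS₁.union_add_inter_le (p := Sigma.fst)
      (fun T => PlanningProblem.admissible_iff) hα.le h.isSubmodular_g hadm₁ hnn₁ hopt.1
    have hmono := h.mutualInfo_mono (Finset.subset_union_right (s₁ := S₁) (s₂ := Sopt))
    have hinter := h.mutualInfo_nonneg (S₁ ∩ Sopt)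
    have hE : P.energy (S₁ ∪ Sopt) + P.energy (S₁ ∩ Sopt) = P.energy S₁ + P.energy Sopt :=
      Finset.sum_union_inter
    have hE₁ := henergy S₁ hadm₁
    -- The union and the intersection together have energy `energy S₁ + energy Sopt` and offset `2
    -- λ`; one `λ` pays for `energy S₁`.
    have hopt_le : P.g Sopt ≤ (2 + α) * P.g S₁ := by
      refine le_trans ?_ key
      simp only [PlanningProblem.g, PlanningProblem.J]
      linarith
    nlinarith [mul_le_mul_of_nonneg_left hle (by positivity : 0 ≤ 2 + α),
      mul_nonneg hα.le (hnn₁.trans hle)]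
  -- The offset is `g ∅`, so `λ > 0` is the positivity of the value at `∅`.
  · refine LocalSearch.exists_isOutput hα PlanningProblem.admissible_empty
      (fun σ hσ => hnn _ (hsingle σ hσ)) (hpos.imp_left fun h0 => ?_)
    simpa [PlanningProblem.g, PlanningProblem.J, PlanningProblem.energy, h.mutualInfo_empty]
      using h0
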